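/- Consider noise-contrastive estimation of the mean of a one-dimensional Gaussian with unit variance. For a parameter $\tau=[b,c]\in\mathbb R^2$ (Euclidean norm) let $p_\tau(x)=\exp\left(-\tfrac{x^2}{2}+bx-c\right)$ be the unnormalized model. Let the data distribution be $P_*=N(R,1)$ with $R>0$ and the noise distribution $Q=N(0,1)$ with density $q$; they correspond to the parameters $\tau_*=\left[R,\tfrac{R^2}{2}+\log\sqrt{2\pi}\right]$ and $\tau_q=\left[0,\log\sqrt{2\pi}\right]$. The NCE loss is $$L(\tau)=\tfrac12\,\mathbb E_{P_*}\log\frac{p_\tau+q}{p_\tau}+\tfrac12\,\mathbb E_{Q}\log\frac{p_\tau+q}{q}.$$ Both expectations exist (the integrands are integrable) and $L$ is differentiable at every $\tau\in\mathbb R^2$. Put $\kappa=\tfrac{9}{16}$ and let $\mathcal A_R=\{\tau:\ 0.1R\le\|\tau-\tau_*\|\le 0.2R\}$. Then: 1. There is an absolute constant $C>0$ such that for all sufficiently large $R$ and all $\tau\in\mathcal A_R$, $$\left|\left\langle\nabla L(\tau),\frac{\tau_*-\tau}{\|\tau_*-\tau\|}\right\rangle\right|\le C\exp\left(-\frac{\kappa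 R^2}{8}\right).$$ 2. Let $\eta=\eta(R)>0$ with $\eta(R)\to0$ as $R\to\infty$, and let $\tau_0=\tau_q$, $\tau_{t+1}=\tau_t-\eta(R)\nabla L(\tau_t)$ be gradient descent with step size $\eta(R)$. For every constant $\delta>0$ and all $R$ sufficiently large (depending on $\eta(\cdot)$ and $\delta$): $\delta<0.1R$ and $\|\tau_0-\tau_*\|>0.2R$, so that gradient descent starts outside the outer circle of $\mathcal A_R$ while the $\delta$-ball around $\tau_*$ lies inside the inner circle; and whenever $\|\tau_t-\tau_*\|\le\delta$, at least $\exp(\kappa R^2/8)$ of the iterates $\tau_0,\dots,\tau_{t-1}$ lie in $\mathcal A_R$. In particular $t\ge\exp(\kappa R^2/8)=\exp(\Omega(R^2))$: gradient descent needs exponentially many steps to reach any constant accuracy. -/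

import Mathlib

open Filter Topology MeasureTheory ProbabilityTheory

namespace NCE

noncomputable section

/-- The parameter space: the Euclidean plane, with points `τ = [b, c]`. -/
abbrev Param : Type := EuclideanSpace ℝ (Fin 2)

/-- The sufficient statistic `T(x) = [x, -1]`. -/
def suffStat (x : ℝ) : Param := !₂[x, -1]

/-- The unnormalized model `p_τ(x) = exp(-x² / 2) exp ⟨τ, T(x)⟩ = exp(-x² / 2 + b x - c)`. -/
def model (τ : Param) (x : ℝ) : ℝ :=
  Real.exp (-x ^ 2 / 2) * Real.exp (inner ℝ τ (suffStat x))

/-- The parameter of the normal law with mean `θ` and variance one (see `model_gaussParam`). -/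
def gaussParam (θ : ℝ) : Param := !₂[θ, θ ^ 2 / 2 + Real.log (Real.sqrt (2 * Real.pi))]

theorem model_gaussParam (θ x : ℝ) : model (gaussParam θ) x = gaussianPDFReal θ 1 x := by
  have h : 0 < Real.sqrt (2 * Real.pi) := Real.sqrt_pos.mpr (by positivity)
  have e : (-x ^ 2 / 2 + inner ℝ (gaussParam θ) (suffStat x)) =
      -Real.log (Real.sqrt (2 * Real.pi)) + -(x - θ) ^ 2 / (2 * 1) := by
    simp [gaussParam, suffStat, PiLp.inner_apply, Fin.sum_univ_two]
    ring
  rw [model, ← Real.exp_add, e, Real.exp_add, Real.exp_neg, Real.exp_log h, gaussianPDFReal]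
  simp

/-- The density `q` of the noise law `N(0, 1)`. -/
def noise (x : ℝ) : ℝ := gaussianPDFReal 0 1 x

/-- The summand `log ((p_τ + q) / p_τ)`, to be integrated against the data law. -/
def dataTerm (τ : Param) (x : ℝ) : ℝ := Real.log ((model τ x + noise x) / model τ x)

/-- The summand `log ((p_τ + q) / q)`, to be integrated against the noise law. -/
def noiseTerm (τ : Param) (x : ℝ) : ℝ := Real.log ((model τ x + noise x) / noise x)

/-- The population loss of noise-contrastive estimation with data law `N(R, 1)` and
noise law `N(0, 1)`. -/
def loss (R : ℝ) (τ : Param) : ℝ :=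
  1 / 2 * ∫ x, dataTerm τ x ∂(gaussianReal R 1) + 1 / 2 * ∫ x, noiseTerm τ x ∂(gaussianReal 0 1)

/-- The `t`-th iterate of gradient descent on the loss with step size `η`, started at the
noise parameter `τ_q`. -/
def gd (R η : ℝ) : ℕ → Param
  | 0 => gaussParam 0
  | t + 1 => gd R η t - η • gradient (loss R) (gd R η t)

/-- The closed annulus around `τ_*` with radii `R / 10` and `R / 5`. -/
def annulus (R : ℝ) : Set Param :=
  {τ | R / 10 ≤ ‖τ - gaussParam R‖ ∧ ‖τ - gaussParam R‖ ≤ R / 5}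

/-- The signed component of the gradient of the loss at `τ` in the direction of `τ_* - τ`. -/
def radialGrad (R : ℝ) (τ : Param) : ℝ :=
  inner ℝ (gradient (loss R) τ) (‖gaussParam R - τ‖⁻¹ • (gaussParam R - τ))

end

end NCE

/-! The log-ratio of model to noise is affine in `x`, so each half of the gradient integrates a
Gaussian density times a sigmoid and the sufficient statistic. The sigmoid switches the Gaussian off
beyond the crossing point `y` of model and noise, so the mass concentrates near `y`, with size `exp
(-(y - m)² / 2)` for mean `m` (`integral_sigmoid_mul_le`). On the disc of radius `R / 5`, `y` is, up
to `1 / R`, at distance at least `3R/8` from both means (`crossing_bounds`). Since `(3R/8)² / 2 =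
κR²/8`, this bounds the whole gradient, hence its radial part.

Elsewhere the gradient is at most `|R| + K`, so steps of size `o(1)` cannot leap the annulus. A
potential argument (`annulus_le_clipped_norm_add`) then charges the crossing to the tiny steps
inside. -/

namespace NCE

noncomputable section

/-! ### Both loss terms as softplus of an affine function. -/

/-- The log-density ratio `log (p_τ / q)`, which is affine in `x`. -/
def logit (τ : Param) (x : ℝ) : ℝ := inner ℝ (τ - gaussParam 0) (suffStat x)

theorem logit_eq (τ : Param) (x : ℝ) :
    logit τ x = τ 0 * x - (τ 1 - Real.log (Real.sqrt (2 * Real.pi))) := by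
  simp [logit, gaussParam, suffStat, PiLp.inner_apply, Fin.sum_univ_two]
  ring

theorem noise_pos (x : ℝ) : 0 < noise x := gaussianPDFReal_pos 0 1 x one_ne_zero

theorem model_eq_noise_mul_exp (τ : Param) (x : ℝ) :
    model τ x = noise x * Real.exp (logit τ x) := by
  rw [noise, ← model_gaussParam, model, model, logit, inner_sub_left, mul_assoc, ← Real.exp_add _ (_ - _),
    add_sub_cancel]

theorem dataTerm_eq (τ : Param) (x : ℝ) :
    dataTerm τ x = Real.log (1 + Real.exp (-1 * logit τ x)) := by
  have h := noise_pos x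
  rw [dataTerm, model_eq_noise_mul_exp, neg_one_mul, Real.exp_neg]
  congr 1
  have := Real.exp_pos (logit τ x)
  field_simp

theorem noiseTerm_eq (τ : Param) (x : ℝ) :
    noiseTerm τ x = Real.log (1 + Real.exp (1 * logit τ x)) := by
  have h := noise_pos x
  rw [noiseTerm, model_eq_noise_mul_exp, one_mul]
  congr 1
  field_simp
  ring

theorem norm_suffStat_le (x : ℝ) : ‖suffStat x‖ ≤ 1 + |x| := by
  rw [EuclideanSpace.norm_eq, Real.sqrt_le_left (by positivity)]
  simp [suffStat, Fin.sum_univ_two]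
  nlinarith [abs_nonneg x, sq_abs x]

@[fun_prop]
theorem continuous_suffStat : Continuous suffStat := by
  unfold suffStat
  fun_prop

@[fun_prop]
theorem continuous_logit (τ : Param) : Continuous (logit τ) := by
  unfold logit
  fun_prop

theorem abs_logit_le (τ : Param) (x : ℝ) : |logit τ x| ≤ ‖τ - gaussParam 0‖ * (1 + |x|) :=
  (abs_real_inner_le_norm _ _).trans (by gcongr; exact norm_suffStat_le x)

/-! ### Integrability and differentiation under the integral sign. -/

theorem integrable_one_add_abs (m : ℝ) :
    Integrable (fun x : ℝ => 1 + |x|) (gaussianReal m 1) := by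
  have h : Integrable (fun x : ℝ => x) (gaussianReal m 1) :=
    (memLp_id_gaussianReal 1).integrable le_rfl
  exact (integrable_const 1).add h.abs

theorem abs_log_one_add_exp_le (z : ℝ) : |Real.log (1 + Real.exp z)| ≤ 1 + |z| := by
  have h0 := Real.exp_pos z
  rw [abs_of_nonneg (Real.log_nonneg (by linarith))]
  rw [Real.log_le_iff_le_exp (by positivity), Real.exp_add]
  have h1 : Real.exp z ≤ Real.exp |z| := Real.exp_le_exp.2 (le_abs_self z)
  have h2 : 1 ≤ Real.exp |z| := Real.one_le_exp (abs_nonneg z)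
  have h3 : 2 ≤ Real.exp 1 := by linarith [Real.add_one_le_exp 1]
  nlinarith

theorem integrable_softplus_logit (m s : ℝ) (τ : Param) :
    Integrable (fun x => Real.log (1 + Real.exp (s * logit τ x))) (gaussianReal m 1) := by
  have hc : Continuous fun x => Real.log (1 + Real.exp (s * logit τ x)) := by
    refine Continuous.log (by fun_prop) fun x => ?_
    positivity
  refine Integrable.mono' ((integrable_const 1).add ((integrable_one_add_abs m).const_mul
    (|s| * ‖τ - gaussParam 0‖))) hc.aestronglyMeasurable (Eventually.of_forall fun x => ?_)
  refine (abs_log_one_add_exp_le _).trans ?_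
  simp only [Pi.add_apply, abs_mul, mul_assoc]
  gcongr
  exact abs_logit_le τ x

theorem hasDerivAt_softplus (z : ℝ) :
    HasDerivAt (fun z => Real.log (1 + Real.exp z)) (Real.sigmoid z) z := by
  have h := ((Real.hasDerivAt_exp z).const_add 1).log (by positivity)
  convert h using 1
  rw [Real.sigmoid_def, Real.exp_neg]
  have := Real.exp_pos z
  field_simp
  ring

/-- The derivative in `τ` of the softplus of `s * logit τ x`. -/
def softplusDeriv (s : ℝ) (τ : Param) (x : ℝ) : Param →L[ℝ] ℝ :=
  Real.sigmoid (s * logit τ x) • s • innerSL ℝ (suffStat x)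

theorem hasFDerivAt_softplus_logit (s : ℝ) (τ : Param) (x : ℝ) :
    HasFDerivAt (fun τ => Real.log (1 + Real.exp (s * logit τ x))) (softplusDeriv s τ x) τ := by
  have h : HasFDerivAt (fun τ => s * logit τ x) (s • innerSL ℝ (suffStat x)) τ := by
    have h1 := (((innerSL ℝ (suffStat x)).hasFDerivAt (x := τ)).sub_const
      (inner ℝ (suffStat x) (gaussParam 0))).const_mul s
    refine h1.congr_of_eventuallyEq (Eventually.of_forall fun σ => ?_)
    simp [logit, inner_sub_left, real_inner_comm]
  exact (hasDerivAt_softplus _).comp_hasFDerivAt τ h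

theorem norm_softplusDeriv_le {s : ℝ} (hs : |s| = 1) (τ : Param) (x : ℝ) :
    ‖softplusDeriv s τ x‖ ≤ Real.sigmoid (s * logit τ x) * (1 + |x|) := by
  rw [softplusDeriv, norm_smul, norm_smul, innerSL_apply_norm, Real.norm_eq_abs, Real.norm_eq_abs,
    hs, one_mul, abs_of_nonneg (Real.sigmoid_nonneg _)]
  exact mul_le_mul_of_nonneg_left (norm_suffStat_le x) (Real.sigmoid_nonneg _)

theorem hasFDerivAt_integral_softplus_logit (m : ℝ) {s : ℝ} (hs : |s| = 1) (τ : Param) :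
    HasFDerivAt (fun τ => ∫ x, Real.log (1 + Real.exp (s * logit τ x)) ∂(gaussianReal m 1))
      (∫ x, softplusDeriv s τ x ∂(gaussianReal m 1)) τ := by
  refine hasFDerivAt_integral_of_dominated_of_fderiv_le (F' := softplusDeriv s)
    (s := Set.univ) (bound := fun x => 1 + |x|) univ_mem
    (Eventually.of_forall fun σ => (integrable_softplus_logit m s σ).aestronglyMeasurable)
    (integrable_softplus_logit m s τ) ?_ (Eventually.of_forall fun x σ _ => ?_)
    (integrable_one_add_abs m)
    (Eventually.of_forall fun x σ _ => hasFDerivAt_softplus_logit s σ x)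
  · refine Continuous.aestronglyMeasurable ?_
    unfold softplusDeriv
    exact (continuous_sigmoid.comp (by fun_prop)).smul (by fun_prop)
  · refine (norm_softplusDeriv_le hs σ x).trans ?_
    exact mul_le_of_le_one_left (by positivity) (Real.sigmoid_le_one _)

theorem integrable_sigmoid_mul (m s : ℝ) (τ : Param) :
    Integrable (fun x => Real.sigmoid (s * logit τ x) * (1 + |x|)) (gaussianReal m 1) := by
  refine (integrable_one_add_abs m).mono' (Continuous.aestronglyMeasurable
    ((continuous_sigmoid.comp (by fun_prop)).mul (by fun_prop))) (Eventually.of_forall fun x => ?_)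
  rw [Real.norm_eq_abs, abs_of_nonneg (mul_nonneg (Real.sigmoid_nonneg _) (by positivity))]
  exact mul_le_of_le_one_left (by positivity) (Real.sigmoid_le_one _)

theorem hasFDerivAt_loss (R : ℝ) (τ : Param) :
    HasFDerivAt (loss R)
      ((1 / 2 : ℝ) • (∫ x, softplusDeriv (-1) τ x ∂(gaussianReal R 1)) +
        (1 / 2 : ℝ) • ∫ x, softplusDeriv 1 τ x ∂(gaussianReal 0 1)) τ := by
  have h1 := hasFDerivAt_integral_softplus_logit R (s := -1) (by simp) τ
  have h2 := hasFDerivAt_integral_softplus_logit 0 (s := 1) (by simp) τ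
  have h := (h1.const_mul (1 / 2)).add (h2.const_mul (1 / 2))
  refine h.congr_of_eventuallyEq (Eventually.of_forall fun σ => ?_)
  simp only [loss, dataTerm_eq, noiseTerm_eq, Pi.add_apply]

theorem norm_gradient_loss_le (R : ℝ) (τ : Param) :
    ‖gradient (loss R) τ‖ ≤
      1 / 2 * (∫ x, Real.sigmoid (-1 * logit τ x) * (1 + |x|) ∂(gaussianReal R 1)) +
        1 / 2 * ∫ x, Real.sigmoid (1 * logit τ x) * (1 + |x|) ∂(gaussianReal 0 1) := by
  rw [gradient, LinearIsometryEquiv.norm_map, (hasFDerivAt_loss R τ).fderiv]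
  refine (norm_add_le _ _).trans ?_
  rw [norm_smul, norm_smul, Real.norm_of_nonneg (by norm_num : (0 : ℝ) ≤ 1 / 2)]
  gcongr
  · exact norm_integral_le_of_norm_le (integrable_sigmoid_mul R (-1) τ)
      (Eventually.of_forall fun x => norm_softplusDeriv_le (by simp) τ x)
  · exact norm_integral_le_of_norm_le (integrable_sigmoid_mul 0 1 τ)
      (Eventually.of_forall fun x => norm_softplusDeriv_le (by simp) τ x)

theorem integral_one_add_abs_le (R : ℝ) :
    ∫ x, (1 + |x|) ∂(gaussianReal R 1) ≤ |R| + ∫ x, (1 + |x|) ∂(gaussianReal 0 1) := by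
  have h : gaussianReal R 1 = (gaussianReal 0 1).map (· + R) := by
    rw [gaussianReal_map_add_const, zero_add]
  have hi : Integrable (fun x : ℝ => 1 + |x + R|) (gaussianReal 0 1) := by
    have := integrable_one_add_abs R
    rw [h] at this
    exact this.comp_measurable (measurable_add_const R)
  rw [h, integral_map (measurable_add_const R).aemeasurable (by fun_prop)]
  calc ∫ x, (1 + |x + R|) ∂(gaussianReal 0 1)
      ≤ ∫ x, (|R| + (1 + |x|)) ∂(gaussianReal 0 1) :=
        integral_mono hi ((integrable_const _).add (integrable_one_add_abs 0))
          fun x => by linarith [abs_add_le x R]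
    _ = _ := by
        rw [integral_add (integrable_const _) (integrable_one_add_abs 0)]
        simp

/-- Growth linear in `R` is what keeps an `o(1)` step short compared with the annulus width `R /
10`. -/
theorem exists_norm_gradient_loss_le :
    ∃ K : ℝ, 0 ≤ K ∧ ∀ (R : ℝ) (τ : Param), ‖gradient (loss R) τ‖ ≤ |R| + K := by
  refine ⟨∫ x, (1 + |x|) ∂(gaussianReal 0 1), integral_nonneg fun x => by positivity,
    fun R τ => (norm_gradient_loss_le R τ).trans ?_⟩
  have key (m s : ℝ) : ∫ x, Real.sigmoid (s * logit τ x) * (1 + |x|) ∂(gaussianReal m 1) ≤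
      ∫ x, (1 + |x|) ∂(gaussianReal m 1) :=
    integral_mono (integrable_sigmoid_mul m s τ) (integrable_one_add_abs m)
      fun x => mul_le_of_le_one_left (by positivity) (Real.sigmoid_le_one _)
  linarith [key R (-1), key 0 1, integral_one_add_abs_le R, abs_nonneg R]

/-! ### Gaussian integrals cut off by a sigmoid. -/

theorem integrable_exp_neg_mul_abs {a : ℝ} (ha : 0 < a) :
    Integrable (fun x : ℝ => Real.exp (-a * |x|)) := by
  rw [← integrableOn_univ, ← Set.Iic_union_Ioi (a := (0 : ℝ)), integrableOn_union]
  constructor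
  · refine (integrableOn_exp_mul_Iic ha 0).congr_fun (fun x hx => ?_) measurableSet_Iic
    simp [abs_of_nonpos (Set.mem_Iic.1 hx)]
  · refine (integrableOn_exp_mul_Ioi (neg_neg_of_pos ha) 0).congr_fun (fun x hx => ?_)
      measurableSet_Ioi
    simp [abs_of_pos (Set.mem_Ioi.1 hx)]

theorem integral_exp_neg_mul_abs {a : ℝ} (ha : 0 < a) :
    ∫ x : ℝ, Real.exp (-a * |x|) = 2 / a := by
  rw [integral_comp_abs (f := fun x => Real.exp (-a * x)),
    integral_exp_mul_Ioi (neg_neg_of_pos ha) 0]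
  simp
  ring

theorem sigmoid_le_exp (z : ℝ) : Real.sigmoid z ≤ Real.exp z := by
  rw [← neg_neg z, ← Real.sigmoid_mul_rexp_neg]
  exact mul_le_of_le_one_left (Real.exp_nonneg _) (Real.sigmoid_le_one _)

theorem gaussianPDFReal_one_le (m x : ℝ) :
    gaussianPDFReal m 1 x ≤ Real.exp (-(x - m) ^ 2 / 2) := by
  rw [gaussianPDFReal]
  simp only [NNReal.coe_one, mul_one]
  refine mul_le_of_le_one_left (Real.exp_nonneg _) (inv_le_one_of_one_le₀ ?_)
  rw [Real.one_le_sqrt]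
  linarith [Real.pi_gt_three]

/-- A Gaussian density cut off by a sigmoid decays exponentially on either side of the crossing
point `y`, at a rate `r` for which the side conditions compare the slopes of the exponents. -/
theorem gaussianPDFReal_mul_sigmoid_le {m y β r : ℝ}
    (hl : r ≤ m - y ∨ r ≤ m - y + β) (hr : r ≤ y - m ∨ r ≤ y - m - β) (x : ℝ) :
    gaussianPDFReal m 1 x * Real.sigmoid (β * (x - y)) ≤
      Real.exp (-(y - m) ^ 2 / 2) * Real.exp (-r * |x - y|) := by
  have h1 : gaussianPDFReal m 1 x * Real.sigmoid (β * (x - y)) ≤ Real.exp (-(x - m) ^ 2 / 2) :=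
    (mul_le_of_le_one_right (gaussianPDFReal_nonneg _ _ _) (Real.sigmoid_le_one _)).trans
      (gaussianPDFReal_one_le m x)
  have h2 : gaussianPDFReal m 1 x * Real.sigmoid (β * (x - y)) ≤
      Real.exp (-(x - m) ^ 2 / 2 + β * (x - y)) := by
    rw [Real.exp_add]
    exact mul_le_mul (gaussianPDFReal_one_le m x) (sigmoid_le_exp _) (Real.sigmoid_nonneg _)
      (Real.exp_nonneg _)
  rw [← Real.exp_add]
  -- Expanding `-(x - m)² / 2` around `y` leaves a linear term and `-(x - y)² / 2`, which is
  -- dropped; on each side `h1` or `h2` supplies the slope.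
  rcases le_total x y with h | h
  · rw [abs_of_nonpos (sub_nonpos.2 h)]
    rcases hl with hl | hl
    · exact h1.trans (Real.exp_le_exp.2 (by nlinarith [sq_nonneg (x - y)]))
    · exact h2.trans (Real.exp_le_exp.2 (by nlinarith [sq_nonneg (x - y)]))
  · rw [abs_of_nonneg (sub_nonneg.2 h)]
    rcases hr with hr | hr
    · exact h1.trans (Real.exp_le_exp.2 (by nlinarith [sq_nonneg (x - y)]))
    · exact h2.trans (Real.exp_le_exp.2 (by nlinarith [sq_nonneg (x - y)]))

theorem integral_sigmoid_mul_le {R m y β : ℝ} (hR : 10 ≤ R) (hy0 : 0 ≤ y) (hy : y ≤ R)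
    (hl : R / 10 ≤ m - y ∨ R / 10 ≤ m - y + β) (hr : R / 10 ≤ y - m ∨ R / 10 ≤ y - m - β) :
    ∫ x, Real.sigmoid (β * (x - y)) * (1 + |x|) ∂(gaussianReal m 1) ≤
      80 * Real.exp (-(y - m) ^ 2 / 2) := by
  have hi := integrable_exp_neg_mul_abs (a := R / 20) (by linarith)
  rw [integral_gaussianReal_eq_integral_smul one_ne_zero]
  calc ∫ x, gaussianPDFReal m 1 x • (Real.sigmoid (β * (x - y)) * (1 + |x|))
      ≤ ∫ x, (2 * R * Real.exp (-(y - m) ^ 2 / 2)) * Real.exp (-(R / 20) * |x - y|) := by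
        refine integral_mono_of_nonneg (Eventually.of_forall fun x => ?_)
          ((hi.comp_sub_right y).const_mul _) (Eventually.of_forall fun x => ?_)
        · exact mul_nonneg (gaussianPDFReal_nonneg _ _ _)
            (mul_nonneg (Real.sigmoid_nonneg _) (by positivity))
        · have h1 := gaussianPDFReal_mul_sigmoid_le hl hr x
          -- Half of the decay rate `R / 10` is spent on absorbing the factor `1 + |x|`; the other
          -- half gives `2R * (2 / (R/20)) = 80`.
          have h2 : 1 + |x| ≤ 2 * R * Real.exp (R / 20 * |x - y|) := by
            have h3 := Real.add_one_le_exp (R / 20 * |x - y|)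
            have h4 : |x| ≤ |x - y| + y := by
              have := abs_add_le (x - y) y
              rwa [sub_add_cancel, abs_of_nonneg hy0] at this
            calc 1 + |x| ≤ 2 * R * (R / 20 * |x - y| + 1) := by
                  have h5 : 1 ≤ R * R / 10 := by nlinarith
                  linarith [mul_le_mul_of_nonneg_right h5 (abs_nonneg (x - y))]
              _ ≤ _ := by gcongr
          have h5 : Real.exp (-(R / 10) * |x - y|) * Real.exp (R / 20 * |x - y|) =
              Real.exp (-(R / 20) * |x - y|) := by
            rw [← Real.exp_add]
            congr 1
            ring
          calc gaussianPDFReal m 1 x • (Real.sigmoid (β * (x - y)) * (1 + |x|))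
              = gaussianPDFReal m 1 x * Real.sigmoid (β * (x - y)) * (1 + |x|) := by
                rw [smul_eq_mul, mul_assoc]
            _ ≤ Real.exp (-(y - m) ^ 2 / 2) * Real.exp (-(R / 10) * |x - y|) *
                (2 * R * Real.exp (R / 20 * |x - y|)) :=
                mul_le_mul h1 h2 (by positivity) (by positivity)
            _ = _ := by simp only [← h5]; ring
    _ = 80 * Real.exp (-(y - m) ^ 2 / 2) := by
        rw [integral_const_mul, integral_sub_right_eq_self (fun x => Real.exp (-(R / 20) * |x|)),
          integral_exp_neg_mul_abs (by linarith)]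
        field_simp
        norm_num

/-! ### Exponentially small gradient on the disc. -/

/-- On the disc of radius `R / 5` around `τ_*`, the point `y` where the model crosses the noise
density stays away from both means. -/
theorem crossing_bounds {R u v y : ℝ} (hR : 20 ≤ R) (huv : u ^ 2 + v ^ 2 ≤ (R / 5) ^ 2)
    (hy : (R + u) * y = R ^ 2 / 2 + v) :
    3 * R / 8 ≤ y ∧ y ≤ 5 * R / 8 + 1 / R := by
  have hu : |u| ≤ R / 5 := abs_le_of_sq_le_sq (by nlinarith) (by linarith)
  have hv : |v| ≤ R / 5 := abs_le_of_sq_le_sq (by nlinarith) (by linarith)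
  rw [abs_le] at hu hv
  have hb : 0 < R + u := by linarith
  constructor
  · refine le_of_mul_le_mul_left ?_ hb
    rw [hy]
    nlinarith
  · refine le_of_mul_le_mul_left ?_ hb
    rw [hy]
    have h1 : (R + u) * (1 / R) ≥ 4 / 5 := by
      rw [mul_one_div, ge_iff_le, le_div_iff₀ (by linarith)]
      linarith
    -- The extreme case is `u = -R/5`, `v = 0`, where `y = 5R/8`. Near it the disc forces `R/5 + u`
    -- to be at least of order `v² / R`, and the slack `1 / R` absorbs the term linear in `v`.
    nlinarith [sq_nonneg (v - 1 / 2)]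

theorem norm_gradient_loss_le_of_norm_sub_le {R : ℝ} (hR : 20 ≤ R) {τ : Param}
    (hτ : ‖τ - gaussParam R‖ ≤ R / 5) :
    ‖gradient (loss R) τ‖ ≤ 160 * Real.exp (-((9 / 16) * R ^ 2 / 8)) := by
  set u : ℝ := τ 0 - R with hu
  set v : ℝ := τ 1 - (R ^ 2 / 2 + Real.log (Real.sqrt (2 * Real.pi))) with hv
  have huv : u ^ 2 + v ^ 2 ≤ (R / 5) ^ 2 := by
    have h := pow_le_pow_left₀ (norm_nonneg _) hτ 2
    rw [EuclideanSpace.norm_sq_eq] at h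
    simpa [Fin.sum_univ_two, gaussParam, hu, hv] using h
  have hu' : |u| ≤ R / 5 := abs_le_of_sq_le_sq (by nlinarith) (by linarith)
  rw [abs_le] at hu'
  have hb : 0 < R + u := by linarith
  obtain ⟨y, hy⟩ : ∃ y, (R + u) * y = R ^ 2 / 2 + v := ⟨_, mul_div_cancel₀ _ hb.ne'⟩
  obtain ⟨hy1, hy2⟩ := crossing_bounds hR huv hy
  have hR1 : 1 / R ≤ 1 / 20 := one_div_le_one_div_of_le (by norm_num) hR
  have hl (s x : ℝ) : s * logit τ x = s * (R + u) * (x - y) := by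
    rw [logit_eq]
    linear_combination s * hy - s * x * hu + s * hv
  -- Away from its mean the Gaussian decays by itself; towards the mean the sigmoid's slope `R + u`
  -- beats its growth.
  have h1 := integral_sigmoid_mul_le (R := R) (m := R) (y := y) (β := -1 * (R + u))
    (by linarith) (by linarith) (by linarith) (Or.inl (by linarith)) (Or.inr (by linarith))
  have h2 := integral_sigmoid_mul_le (R := R) (m := 0) (y := y) (β := 1 * (R + u))
    (by linarith) (by linarith) (by linarith) (Or.inr (by linarith)) (Or.inl (by linarith))
  have e1 : Real.exp (-(y - R) ^ 2 / 2) ≤ 3 * Real.exp (-((9 / 16) * R ^ 2 / 8)) := by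
    have h3 : (3 * R / 8 - 1 / R) ^ 2 ≤ (R - y) ^ 2 :=
      pow_le_pow_left₀ (by linarith) (by linarith) 2
    have h4 : (3 * R / 8 - 1 / R) ^ 2 = 9 * R ^ 2 / 64 - 3 / 4 + (1 / R) ^ 2 := by
      field_simp
      ring
    have h5 : Real.exp 1 ≤ 3 := by linarith [Real.exp_one_lt_d9]
    calc Real.exp (-(y - R) ^ 2 / 2) ≤ Real.exp (1 + -((9 / 16) * R ^ 2 / 8)) :=
          Real.exp_le_exp.2 (by nlinarith [sq_nonneg (1 / R)])
      _ ≤ _ := by rw [Real.exp_add]; gcongr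
  have e2 : Real.exp (-(y - 0) ^ 2 / 2) ≤ Real.exp (-((9 / 16) * R ^ 2 / 8)) :=
    Real.exp_le_exp.2 (by nlinarith)
  have h := norm_gradient_loss_le R τ
  simp only [hl] at h
  -- `160 = (80 * 3 + 80) / 2`.
  linarith

theorem abs_radialGrad_le (R : ℝ) (τ : Param) : |radialGrad R τ| ≤ ‖gradient (loss R) τ‖ := by
  refine (abs_real_inner_le_norm _ _).trans (mul_le_of_le_one_right (norm_nonneg _) ?_)
  rw [norm_smul, norm_inv, norm_norm]
  -- This includes `τ = τ_*`, where the inverse norm is `0`.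
  exact inv_mul_le_one

theorem le_norm_gaussParam_zero_sub (R : ℝ) : R ≤ ‖gaussParam 0 - gaussParam R‖ := by
  have h := PiLp.norm_apply_le (gaussParam 0 - gaussParam R) 0
  refine (le_abs_self R).trans ?_
  simpa [gaussParam] using h

/-! ### Counting visits to the annulus. -/

/-- The iterates before time `t` that lie in the annulus. -/
def annulusVisits (R η : ℝ) (t : ℕ) : Set ℕ := {s | s < t ∧ gd R η s ∈ annulus R}

theorem finite_annulusVisits (R η : ℝ) (t : ℕ) : (annulusVisits R η t).Finite :=
  (Set.finite_Iio t).subset fun _ h => h.1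

theorem ncard_annulusVisits_le (R η : ℝ) (t : ℕ) : (annulusVisits R η t).ncard ≤ t := by
  have h : annulusVisits R η t ⊆ (Finset.range t : Set ℕ) := fun s hs => by
    simpa using hs.1
  simpa only [Set.ncard_coe_finset, Finset.card_range] using
    Set.ncard_le_ncard h (Finset.finite_toSet _)

theorem ncard_annulusVisits_mono (R η : ℝ) (t : ℕ) :
    (annulusVisits R η t).ncard ≤ (annulusVisits R η (t + 1)).ncard :=
  Set.ncard_le_ncard (fun _ hs => ⟨hs.1.trans (Nat.lt_succ_self t), hs.2⟩)
    (finite_annulusVisits R η (t + 1))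

theorem ncard_annulusVisits_succ {R η : ℝ} {t : ℕ} (h : gd R η t ∈ annulus R) :
    (annulusVisits R η (t + 1)).ncard = (annulusVisits R η t).ncard + 1 := by
  have e : annulusVisits R η (t + 1) = insert t (annulusVisits R η t) := by
    ext s
    simp only [annulusVisits, Set.mem_ofPred_eq, Set.mem_insert_iff, Nat.lt_succ_iff_lt_or_eq]
    constructor
    · rintro ⟨hs | rfl, h2⟩
      · exact Or.inr ⟨hs, h2⟩
      · exact Or.inl rfl
    · rintro (rfl | ⟨hs, h2⟩)
      · exact ⟨Or.inr rfl, h⟩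
      · exact ⟨Or.inl hs, h2⟩
  rw [e, Set.ncard_insert_of_notMem (fun h => lt_irrefl _ h.1) (finite_annulusVisits R η t)]

theorem norm_gd_sub_le (R : ℝ) {η : ℝ} (hη : 0 ≤ η) (t : ℕ) :
    ‖gd R η t - gaussParam R‖ - η * ‖gradient (loss R) (gd R η t)‖ ≤
      ‖gd R η (t + 1) - gaussParam R‖ := by
  have h := norm_sub_norm_le (gd R η t - gaussParam R) (η • gradient (loss R) (gd R η t))
  rw [norm_smul, Real.norm_of_nonneg hη, sub_right_comm] at h
  exact h

/-- If no step from outside the annulus crosses more than half of it, and steps inside move by at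
most `ε`, then gradient descent has to spend its way through the annulus. -/
theorem annulus_le_clipped_norm_add {R η ε : ℝ} (hη : 0 ≤ η) (hR : 0 < R) (hε : 0 ≤ ε)
    (hout : ∀ τ, η * ‖gradient (loss R) τ‖ ≤ R / 20)
    (hin : ∀ τ ∈ annulus R, η * ‖gradient (loss R) τ‖ ≤ ε) (t : ℕ) :
    3 * R / 20 ≤ max (R / 10) (min ‖gd R η t - gaussParam R‖ (3 * R / 20)) +
      (annulusVisits R η t).ncard * ε := by
  induction t with
  | zero =>
    have h : R ≤ ‖gd R η 0 - gaussParam R‖ := le_norm_gaussParam_zero_sub R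
    rw [min_eq_right (by linarith)]
    exact (le_max_right _ _).trans (le_add_of_nonneg_right (by positivity))
  | succ t ih =>
    have hs := norm_gd_sub_le R hη t
    have hm : ((annulusVisits R η t).ncard : ℝ) * ε ≤ (annulusVisits R η (t + 1)).ncard * ε := by
      exact mul_le_mul_of_nonneg_right (Nat.cast_le.2 (ncard_annulusVisits_mono R η t)) hε
    have hle := le_max_left (R / 10) (min ‖gd R η (t + 1) - gaussParam R‖ (3 * R / 20))
    -- Inside, the clipped norm drops by at most `ε` and the count rises by one. Within the inner
    -- circle it is already minimal; beyond the outer one a step leaves the norm at least `R/5 -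
    -- R/20 = 3R/20`, so it stays maximal.
    by_cases ha : gd R η t ∈ annulus R
    · rw [ncard_annulusVisits_succ ha]
      push_cast
      have := hin _ ha
      have h : max (R / 10) (min ‖gd R η t - gaussParam R‖ (3 * R / 20)) ≤
          max (R / 10) (min ‖gd R η (t + 1) - gaussParam R‖ (3 * R / 20)) + ε := by
        refine max_le (by linarith) ?_
        refine le_trans ?_ (add_le_add_left (le_max_right _ _) ε)
        rw [min_add]
        exact min_le_min (by linarith) (by linarith)
      linarith
    · rcases lt_or_ge ‖gd R η t - gaussParam R‖ (R / 10) with h | h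
      · rw [max_eq_left ((min_le_left _ _).trans h.le)] at ih
        linarith
      · have h2 : R / 5 < ‖gd R η t - gaussParam R‖ := by
          by_contra hc
          exact ha ⟨h, not_lt.1 hc⟩
        have := hout (gd R η t)
        rw [min_eq_right (by linarith)]
        exact (le_max_right _ _).trans (le_add_of_nonneg_right (by positivity))

end

end NCE

theorem mainTheorem1 :
    -- the loss is a genuine, differentiable function of the parameter
    (∀ (R : ℝ) (τ : NCE.Param),
      Integrable (NCE.dataTerm τ) (gaussianReal R 1) ∧
      Integrable (NCE.noiseTerm τ) (gaussianReal 0 1) ∧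
      DifferentiableAt ℝ (NCE.loss R) τ) ∧
    -- the radial component of the gradient is exponentially small on the annulus
    (∃ C : ℝ, 0 < C ∧ ∀ᶠ R : ℝ in atTop, ∀ τ ∈ NCE.annulus R,
      |NCE.radialGrad R τ| ≤ C * Real.exp (-((9 / 16) * R ^ 2 / 8))) ∧
    -- gradient descent with step size `o(1)`: it starts beyond the annulus, and before it is
    -- `δ`-accurate it spends exponentially many steps inside the annulus
    (∀ η : ℝ → ℝ, (∀ᶠ R : ℝ in atTop, 0 < η R) → Tendsto η atTop (𝓝 0) →
      ∀ δ : ℝ, 0 < δ → ∀ᶠ R : ℝ in atTop,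
        δ < R / 10 ∧ R / 5 < ‖NCE.gd R (η R) 0 - NCE.gaussParam R‖ ∧
        ∀ t : ℕ, ‖NCE.gd R (η R) t - NCE.gaussParam R‖ ≤ δ →
          Real.exp ((9 / 16) * R ^ 2 / 8) ≤ (t : ℝ) ∧
          Real.exp ((9 / 16) * R ^ 2 / 8) ≤
            (Set.ncard {s : ℕ | s < t ∧ NCE.gd R (η R) s ∈ NCE.annulus R} : ℝ)) := by
  refine ⟨fun R τ => ⟨?_, ?_, (NCE.hasFDerivAt_loss R τ).differentiableAt⟩,
    ⟨160, by norm_num, ?_⟩, fun η hpos hη δ hδ => ?_⟩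
  · rw [funext (NCE.dataTerm_eq τ)]
    exact NCE.integrable_softplus_logit R (-1) τ
  · rw [funext (NCE.noiseTerm_eq τ)]
    exact NCE.integrable_softplus_logit 0 1 τ
  · filter_upwards [eventually_ge_atTop 20] with R hR τ hτ
    exact (NCE.abs_radialGrad_le R τ).trans (NCE.norm_gradient_loss_le_of_norm_sub_le hR hτ.2)
  · obtain ⟨K, hK0, hK⟩ := NCE.exists_norm_gradient_loss_le
    filter_upwards [hpos, hη.eventually_lt_const (by norm_num : (0 : ℝ) < 1 / 160),
      eventually_ge_atTop 20, eventually_ge_atTop K, eventually_gt_atTop (10 * δ)]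
      with R hη0 hη1 hR hRK hRδ
    have h0 : R ≤ ‖NCE.gd R (η R) 0 - NCE.gaussParam R‖ := NCE.le_norm_gaussParam_zero_sub R
    refine ⟨by linarith, by linarith, fun t ht => ?_⟩
    have hclip := NCE.annulus_le_clipped_norm_add (R := R) hη0.le (by linarith)
      (ε := Real.exp (-((9 / 16) * R ^ 2 / 8))) (Real.exp_nonneg _)
      (fun τ => by
        have h := hK R τ
        rw [abs_of_nonneg (by linarith)] at h
        nlinarith)
      (fun τ hτ => by
        have h := NCE.norm_gradient_loss_le_of_norm_sub_le hR hτ.2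
        nlinarith [Real.exp_pos (-((9 / 16) * R ^ 2 / 8))]) t
    -- Within `δ < R/10` of the target the clipped norm is `R/10`, so visits times `ε` is at least
    -- `R/20 ≥ 1`.
    rw [max_eq_left ((min_le_left _ _).trans (by linarith)), Real.exp_neg] at hclip
    have hN : Real.exp ((9 / 16) * R ^ 2 / 8) ≤ ((NCE.annulusVisits R (η R) t).ncard : ℝ) := by
      have h1 : 1 ≤ ((NCE.annulusVisits R (η R) t).ncard : ℝ) *
          (Real.exp ((9 / 16) * R ^ 2 / 8))⁻¹ := by linarith
      rwa [← div_eq_mul_inv, one_le_div (Real.exp_pos _)] at h1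
    exact ⟨hN.trans (Nat.cast_le.2 (NCE.ncard_annulusVisits_le R (η R) t)), hN⟩
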